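/- All graphs are finite and simple, and $\log$ denotes the logarithm to base $2$. For a graph $H$, let $\pi(H)$ be the smallest cardinality of a family $\mathcal F$ of permutations (linear orders) of $V(H)$ such that for every two disjoint edges $e,f$ of $H$ there is a permutation in $\mathcal F$ in which all vertices of one of the two edges precede all vertices of the other. Let $G^{1/2}$ be the graph obtained from $G$ by subdividing every edge of $G$ exactly once, and let $\chi(G)$ be the chromatic number of $G$. Then $$\pi(G^{1/2}) \;\le\; \log\log(\chi(G)-1) + \Bigl(\tfrac12+o(1)\Bigr)\log\log\log(\chi(G)-1) + 2,$$ where $o(1)$ is a quantity that depends only on $\chi(G)$ and tends to $0$ as $\chi(G)\to\infty$. Precisely: there is a function $\varepsilon:\mathbb N\to\mathbb R$ with $\varepsilon(n)\to 0$ as $n\to\infty$ such that every graph $G$ with $\chi=\chi(G)\ge 6$ (equivalently, for which $\log\log\log(\chi-1)$ is defined and positive) satisfies $$\pi(G^{1/2}) \le \log\log(\chi-1) + \bigl(\tfrac12+\varepsilon(\chi)\bigr)\log\log\log(\chi-1) + 2 .$$ -/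

import Mathlib

universe u

/-- For a permutation `σ` of `V` (a bijection from `V` onto an initial segment of the naturals),
`A ≺_σ B`: every element of `A` precedes every element of `B` in `σ`. -/
def Precedes {V : Type*} (σ : V ≃ Fin (Nat.card V)) (A B : Set V) : Prop :=
  ∀ a ∈ A, ∀ b ∈ B, σ a < σ b

/-- `σ` separates `A` and `B` if `A ≺_σ B` or `B ≺_σ A`. -/
def Separates {V : Type*} (σ : V ≃ Fin (Nat.card V)) (A B : Set V) : Prop :=
  Precedes σ A B ∨ Precedes σ B A

/-- A family `F` of permutations of `V` is pairwise suitable for the hypergraph with vertex set `V`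
and edge set `E` if any two disjoint edges are separated by some member of `F`. -/
def PairwiseSuitable {V : Type*} (E : Set (Set V)) (F : Finset (V ≃ Fin (Nat.card V))) : Prop :=
  ∀ e ∈ E, ∀ f ∈ E, Disjoint e f → ∃ σ ∈ F, Separates σ e f

/-- The separation dimension of the finite hypergraph with vertex set `V` and edge set `E`: the
cardinality of a smallest pairwise suitable family of permutations. -/
noncomputable def hypergraphSeparationDimension (V : Type*) [Finite V] (E : Set (Set V)) : ℕ :=
  sInf {k : ℕ | ∃ F : Finset (V ≃ Fin (Nat.card V)), F.card = k ∧ PairwiseSuitable E F}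

/-- Two disjoint sets of vertices are separated by some permutation. -/
theorem exists_separates {V : Type*} [Finite V] (A B : Set V) (h : Disjoint A B) :
    ∃ σ : V ≃ Fin (Nat.card V), Separates σ A B := by
  classical
  let g : Fin (Nat.card V) → ℕ := fun i => if (Finite.equivFin V).symm i ∈ A then 0 else 1
  refine ⟨(Finite.equivFin V).trans (Tuple.sort g).symm, Or.inl ?_⟩
  intro a ha b hb
  have hb' : b ∉ A := fun hbA => Set.disjoint_left.mp h hbA hb
  by_contra hlt
  have hm := Tuple.monotone_sort g (not_lt.mp hlt)
  simp [g, ha, hb'] at hm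

/-- The infimum in `hypergraphSeparationDimension` is attained. -/
theorem exists_pairwiseSuitable_card_eq (V : Type*) [Finite V] (E : Set (Set V)) :
    ∃ F : Finset (V ≃ Fin (Nat.card V)),
      F.card = hypergraphSeparationDimension V E ∧ PairwiseSuitable E F := by
  classical
  have := Fintype.ofFinite V
  refine Nat.sInf_mem
    (s := {k : ℕ | ∃ F : Finset (V ≃ Fin (Nat.card V)), F.card = k ∧ PairwiseSuitable E F}) ?_
  refine ⟨_, Finset.univ, rfl, fun e _ f _ hd => ?_⟩
  obtain ⟨σ, hσ⟩ := exists_separates e f hd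
  exact ⟨σ, Finset.mem_univ _, hσ⟩

/-- The separation dimension `π(G)` of a finite graph, viewed as a 2-uniform hypergraph. -/
noncomputable def separationDimension {V : Type*} [Finite V] (G : SimpleGraph V) : ℕ :=
  hypergraphSeparationDimension V ((fun e : Sym2 V => (e : Set V)) '' G.edgeSet)

/-- The fully subdivided graph `G^{1/2}`: its vertices are the vertices of `G` together with one new
vertex for every edge of `G`, and the new vertex of an edge is adjacent exactly to the two ends of
that edge. -/
def fullSubdivision {V : Type*} (G : SimpleGraph V) : SimpleGraph (V ⊕ G.edgeSet) where
  Adj x y :=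
    match x, y with
    | Sum.inl v, Sum.inr e => v ∈ (e : Sym2 V)
    | Sum.inr e, Sum.inl v => v ∈ (e : Sym2 V)
    | Sum.inl _, Sum.inl _ => False
    | Sum.inr _, Sum.inr _ => False
  symm := ⟨by
    rintro (v | e) (w | f) h <;> exact h⟩
  loopless := ⟨by
    rintro (v | e) h <;> exact h⟩

/-!
Fix a proper colouring `c` of `G` with colours below `2 ^ N` and direct every edge `e` from its end
`lo e` of smaller colour to its end `hi e` of larger colour. Two disjoint edges of `G^{1/2}` that
both contain a lower end are separated by placing every subdivision vertex next to its lower end,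
and likewise for upper ends. The delicate pairs are `{lo e, e}` and `{hi f, f}`. Label `e` with the
highest binary digit in which the colours of its ends differ, and cut the interval between these
colours where that digit flips. If the labels of `e` and `f` are equal and `c (lo e) ≤ c (hi f)`,
then the cut of `e` is at most that of `f`, so it works to place every subdivision vertex at its
cut, with ties broken in two opposite ways; if `c (hi f) < c (lo e)`, the placement at the lower
ends works. If the labels differ, it works to place `e` next to `lo e` and `f` next to `hi f`;
encoding the labels by an antichain of subsets of `ι`, one
permutation for each element of `ι` suffices. The middle layer of the subsets of a `2 * m`-set
encodes `N = centralBinom m` labels at the cost of `2 * m + 4` permutations. Since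
`log (centralBinom m) ≥ 2 * m - (log m) / 2 - 1`, this gives the bound up to an additive constant,
which the `o(1)` term absorbs.
-/

section Sorting

variable {X α : Type*} [Finite X] [LinearOrder α]

/-- A permutation of a finite type that lists its elements in increasing order of the key `k`.
The order among elements with the same key is arbitrary. -/
noncomputable def sortPerm (k : X → α) : X ≃ Fin (Nat.card X) :=
  (Finite.equivFin X).trans (Tuple.sort (k ∘ (Finite.equivFin X).symm)).symm

theorem sortPerm_lt_sortPerm {k : X → α} {x y : X} (h : k x < k y) :
    sortPerm k x < sortPerm k y := by
  by_contra hle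
  have hmono := Tuple.monotone_sort (k ∘ (Finite.equivFin X).symm) (not_lt.mp hle)
  simp only [sortPerm, Function.comp_apply, Equiv.trans_apply, Equiv.apply_symm_apply,
    Equiv.symm_apply_apply] at hmono
  exact hmono.not_gt h

theorem precedes_sortPerm_pair {k : X → α} {a a' b b' : X} (hab : k a < k b) (hab' : k a < k b')
    (ha'b : k a' < k b) (ha'b' : k a' < k b') : Precedes (sortPerm k) {a, a'} {b, b'} := by
  rintro _ (rfl | rfl) _ (rfl | rfl) <;> apply sortPerm_lt_sortPerm <;> assumption

end Sorting

section Subdivision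

theorem Separates.symm {V : Type*} {σ : V ≃ Fin (Nat.card V)} {A B : Set V}
    (h : Separates σ A B) : Separates σ B A :=
  Or.symm h

theorem hypergraphSeparationDimension_le_card {X ι : Type*} [Finite X] [Fintype ι]
    {E : Set (Set X)} (σ : ι → (X ≃ Fin (Nat.card X)))
    (h : ∀ e ∈ E, ∀ f ∈ E, Disjoint e f → ∃ i, Separates (σ i) e f) :
    hypergraphSeparationDimension X E ≤ Fintype.card ι := by
  classical
  have hsuitable : PairwiseSuitable E (Finset.univ.image σ) := by
    simpa [PairwiseSuitable] using h
  calc hypergraphSeparationDimension X E ≤ (Finset.univ.image σ).card :=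
        Nat.sInf_le ⟨_, rfl, hsuitable⟩
    _ ≤ Fintype.card ι := Finset.card_image_le

theorem exists_eq_mk_of_mem_edgeSet_fullSubdivision {V : Type*} {G : SimpleGraph V}
    {x : Sym2 (V ⊕ G.edgeSet)} (hx : x ∈ (fullSubdivision G).edgeSet) :
    ∃ (v : V) (e : G.edgeSet), v ∈ (e : Sym2 V) ∧ x = s(Sum.inl v, Sum.inr e) := by
  induction x with
  | _ a b =>
    rcases a with v | e <;> rcases b with w | f
    · exact hx.elim
    · exact ⟨v, f, hx, rfl⟩
    · exact ⟨w, e, hx, Sym2.eq_swap⟩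
    · exact hx.elim

theorem separationDimension_fullSubdivision_le_card {V ι : Type*} [Finite V] [Fintype ι]
    {G : SimpleGraph V} (σ : ι → (V ⊕ G.edgeSet ≃ Fin (Nat.card (V ⊕ G.edgeSet))))
    (h : ∀ (v w : V) (e f : G.edgeSet), v ∈ (e : Sym2 V) → w ∈ (f : Sym2 V) → v ≠ w → e ≠ f →
      ∃ i, Separates (σ i) {Sum.inl v, Sum.inr e} {Sum.inl w, Sum.inr f}) :
    separationDimension (fullSubdivision G) ≤ Fintype.card ι := by
  refine hypergraphSeparationDimension_le_card σ ?_
  rintro _ ⟨x, hx, rfl⟩ _ ⟨y, hy, rfl⟩ hdisj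
  obtain ⟨v, e, hv, rfl⟩ := exists_eq_mk_of_mem_edgeSet_fullSubdivision hx
  obtain ⟨w, f, hw, rfl⟩ := exists_eq_mk_of_mem_edgeSet_fullSubdivision hy
  simp only [Sym2.coe_mk] at hdisj ⊢
  refine h v w e f hv hw ?_ ?_
  · rintro rfl
    exact Set.disjoint_left.mp hdisj (Set.mem_insert _ _) (Set.mem_insert _ _)
  · rintro rfl
    exact Set.disjoint_left.mp hdisj (Set.mem_insert_of_mem _ rfl) (Set.mem_insert_of_mem _ rfl)

end Subdivision

section Keys

variable {V E α β : Type*} [Finite V] [Finite E] [LinearOrder α] [LinearOrder β]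

theorem separates_sortPerm_sumElim_id [LinearOrder V] {p : E → V} {e f : E} (h : p e ≠ p f) :
    Separates (sortPerm (Sum.elim id p)) {Sum.inl (p e), Sum.inr e} {Sum.inl (p f), Sum.inr f} := by
  rcases h.lt_or_gt with h | h
  · exact .inl (precedes_sortPerm_pair h h h h)
  · exact .inr (precedes_sortPerm_pair h h h h)

/-- The key that sorts the vertices by the colouring `c` and inserts each edge `e` immediately below
the vertices of colour `cut e`; edges with the same cut are sorted by `rank`. -/
def cutKey (c : V → α) (cut : E → α) (rank : E → β) : V ⊕ E → α ×ₗ WithTop β :=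
  Sum.elim (fun v => toLex (c v, ⊤)) (fun e => toLex (cut e, ↑(rank e)))

theorem precedes_sortPerm_cutKey {c : V → α} {cut : E → α} {rank : E → β} {v w : V} {e f : E}
    (hv : c v < cut e) (hef : cut e ≤ cut f) (hw : cut f ≤ c w) (hrank : rank e < rank f) :
    Precedes (sortPerm (cutKey c cut rank)) {Sum.inl v, Sum.inr e} {Sum.inl w, Sum.inr f} := by
  apply precedes_sortPerm_pair <;>
    simp only [cutKey, Sum.elim_inl, Sum.elim_inr, Prod.Lex.toLex_lt_toLex']
  · exact ⟨(hv.trans_le (hef.trans hw)).le, fun h => absurd h (hv.trans_le (hef.trans hw)).ne⟩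
  · exact ⟨(hv.trans_le hef).le, fun h => absurd h (hv.trans_le hef).ne⟩
  · exact ⟨hef.trans hw, fun _ => WithTop.coe_lt_top _⟩
  · exact ⟨hef, fun _ => WithTop.coe_lt_coe.mpr hrank⟩

end Keys

theorem exists_linearOrder_monotone {V α : Type*} [LinearOrder α] (c : V → α) :
    ∃ _ : LinearOrder V, Monotone c := by
  let wellOrder : LinearOrder V := IsWellOrder.linearOrder WellOrderingRel
  refine ⟨LinearOrder.lift' (fun v => toLex (c v, v)) fun v w h => congrArg Prod.snd h, ?_⟩
  intro v w (h : toLex (c v, v) ≤ toLex (c w, w))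
  exact (Prod.Lex.toLex_le_toLex'.mp h).1

theorem eq_inf_or_eq_sup_of_mem {α : Type*} [LinearOrder α] {a : α} {z : Sym2 α} (h : a ∈ z) :
    a = z.inf ∨ a = z.sup := by
  rwa [← Sym2.mem_iff, show s(z.inf, z.sup) = z from Sym2.sortEquiv.left_inv z]

theorem separationDimension_fullSubdivision_le_of_cut {V ι α D : Type*} [Finite V] [Fintype ι]
    [LinearOrder V] [LinearOrder α] {G : SimpleGraph V} {c : V → α} (hc : Monotone c)
    {S : D → Finset ι} (hS : Pairwise fun i j => ¬ S i ⊆ S j)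
    {label : G.edgeSet → D} {cut : G.edgeSet → α}
    (hlo : ∀ e : G.edgeSet, c (e : Sym2 V).inf < cut e)
    (hhi : ∀ e : G.edgeSet, cut e ≤ c (e : Sym2 V).sup)
    (hcut : ∀ e f : G.edgeSet, label e = label f → c (e : Sym2 V).inf ≤ c (f : Sym2 V).sup →
      cut e ≤ cut f) :
    separationDimension (fullSubdivision G) ≤ Fintype.card ι + 4 := by
  classical
  let lo (e : G.edgeSet) : V := (e : Sym2 V).inf
  let hi (e : G.edgeSet) : V := (e : Sym2 V).sup
  let rank := Finite.equivFin G.edgeSet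
  let σ : ι ⊕ Fin 4 → (V ⊕ G.edgeSet ≃ Fin (Nat.card (V ⊕ G.edgeSet))) :=
    Sum.elim (fun s => sortPerm (Sum.elim id fun e => if s ∈ S (label e) then lo e else hi e))
      ![sortPerm (Sum.elim id lo), sortPerm (Sum.elim id hi), sortPerm (cutKey c cut rank),
        sortPerm (cutKey c cut (OrderDual.toDual ∘ rank))]
  have separates_lo_hi (e f : G.edgeSet) (hef : e ≠ f) (hvw : lo e ≠ hi f) :
      ∃ i, Separates (σ i) {Sum.inl (lo e), Sum.inr e} {Sum.inl (hi f), Sum.inr f} := by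
    by_cases hlabel : label e = label f
    · rcases lt_or_ge (c (hi f)) (c (lo e)) with h | h
      · have hhl : hi f < lo e := hc.reflect_lt h
        have hll : lo f < lo e := (Sym2.inf_le_sup _).trans_lt hhl
        exact ⟨.inr 0, .inr (precedes_sortPerm_pair hhl hhl hll hll)⟩
      · have hle := hcut e f hlabel h
        rcases (rank.injective.ne hef).lt_or_gt with hr | hr
        · exact ⟨.inr 2, .inl (precedes_sortPerm_cutKey (hlo e) hle (hhi f) hr)⟩
        · exact ⟨.inr 3, .inl (precedes_sortPerm_cutKey (hlo e) hle (hhi f) hr)⟩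
    · obtain ⟨s, hse, hsf⟩ := Finset.not_subset.mp (hS hlabel)
      have hsep := separates_sortPerm_sumElim_id (e := e) (f := f)
        (p := fun e => if s ∈ S (label e) then lo e else hi e) (by simpa [hse, hsf] using hvw)
      simp only [if_pos hse, if_neg hsf] at hsep
      exact ⟨.inl s, hsep⟩
  refine (separationDimension_fullSubdivision_le_card σ ?_).trans (by simp)
  intro v w e f hv hw hvw hef
  rcases eq_inf_or_eq_sup_of_mem hv with rfl | rfl <;>
    rcases eq_inf_or_eq_sup_of_mem hw with rfl | rfl
  · exact ⟨.inr 0, separates_sortPerm_sumElim_id hvw⟩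
  · exact separates_lo_hi e f hef hvw
  · exact (separates_lo_hi f e hef.symm hvw.symm).imp fun _ => Separates.symm
  · exact ⟨.inr 1, separates_sortPerm_sumElim_id hvw⟩

theorem exists_div_two_pow_eq_two_mul {N a b : ℕ} (hab : a < b) (hb : b < 2 ^ N) :
    ∃ (d : Fin N) (k : ℕ), a / 2 ^ (d : ℕ) = 2 * k ∧ b / 2 ^ (d : ℕ) = 2 * k + 1 := by
  induction N generalizing a b with
  | zero => omega
  | succ N ih =>
    by_cases h : a / 2 < b / 2
    · obtain ⟨d, k, ha, hb⟩ := ih h (by omega)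
      refine ⟨d.succ, k, ?_⟩
      simpa only [Fin.val_succ, pow_succ', ← Nat.div_div_eq_div_mul] using And.intro ha hb
    · refine ⟨0, a / 2, ?_⟩
      simp only [Fin.val_zero, pow_zero, Nat.div_one]
      omega

theorem exists_label_cut {E : Type*} {N : ℕ} {a b : E → ℕ} (hab : ∀ e, a e < b e)
    (hb : ∀ e, b e < 2 ^ N) :
    ∃ (label : E → Fin N) (cut : E → ℕ), (∀ e, a e < cut e) ∧ (∀ e, cut e ≤ b e) ∧
      ∀ e f, label e = label f → a e ≤ b f → cut e ≤ cut f := by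
  choose d k ha hb using fun e => exists_div_two_pow_eq_two_mul (hab e) (hb e)
  refine ⟨d, fun e => (2 * k e + 1) * 2 ^ (d e : ℕ), fun e => ?_, fun e => ?_, fun e f hd hle => ?_⟩
  · rw [← Nat.div_lt_iff_lt_mul (by positivity), ha]
    exact Nat.lt_succ_self _
  · rw [← Nat.le_div_iff_mul_le (by positivity), hb]
  · have hdiv : 2 * k e ≤ 2 * k f + 1 := by
      rw [← ha, ← hb, hd]
      exact Nat.div_le_div_right hle
    simp only [hd]
    gcongr
    omega

theorem separationDimension_fullSubdivision_le_card_add_four {V ι : Type*} [Finite V] [Fintype ι]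
    {G : SimpleGraph V} {N : ℕ} (hG : G.Colorable (2 ^ N)) {S : Fin N → Finset ι}
    (hS : Pairwise fun i j => ¬ S i ⊆ S j) :
    separationDimension (fullSubdivision G) ≤ Fintype.card ι + 4 := by
  obtain ⟨C⟩ := hG
  let c (v : V) : ℕ := C v
  obtain ⟨_, hc⟩ := exists_linearOrder_monotone c
  have hlt (e : G.edgeSet) : c (e : Sym2 V).inf < c (e : Sym2 V).sup := by
    obtain ⟨e, he⟩ := e
    refine (hc (Sym2.inf_le_sup e)).lt_of_ne fun h => ?_
    rw [← Sym2.sortEquiv.left_inv e] at he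
    exact C.valid he (Fin.ext h)
  obtain ⟨label, cut, hlo, hhi, hcut⟩ := exists_label_cut hlt fun e => (C (e : Sym2 V).sup).2
  exact separationDimension_fullSubdivision_le_of_cut hc hS hlo hhi hcut

theorem exists_pairwise_not_subset_choose (n r : ℕ) :
    ∃ S : Fin (n.choose r) → Finset (Fin n), Pairwise fun i j => ¬ S i ⊆ S j := by
  have hcard : (Finset.powersetCard r (Finset.univ : Finset (Fin n))).card = n.choose r := by simp
  let layer := (Finset.equivFinOfCardEq hcard).symm
  exact ⟨fun i => layer i, fun i j hij => (Set.sized_powersetCard _ r).isAntichain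
    (layer i).2 (layer j).2 (Subtype.coe_injective.ne (layer.injective.ne hij))⟩

theorem separationDimension_fullSubdivision_le_two_mul_add_four {V : Type*} [Finite V]
    {G : SimpleGraph V} {m : ℕ} (hG : G.Colorable (2 ^ m.centralBinom)) :
    separationDimension (fullSubdivision G) ≤ 2 * m + 4 := by
  obtain ⟨S, hS⟩ := exists_pairwise_not_subset_choose (2 * m) m
  simpa using separationDimension_fullSubdivision_le_card_add_four hG hS

section Asymptotics

open Filter Real

theorem sixteen_pow_le_four_mul_mul_centralBinom_sq {m : ℕ} (hm : 1 ≤ m) :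
    16 ^ m ≤ 4 * m * m.centralBinom ^ 2 := by
  induction m, hm using Nat.le_induction with
  | base => simp [Nat.centralBinom]
  | succ m _ ih =>
    refine Nat.le_of_mul_le_mul_left (c := m + 1) ?_ m.succ_pos
    calc (m + 1) * 16 ^ (m + 1) = 16 * (m + 1) * 16 ^ m := by ring
      _ ≤ 16 * (m + 1) * (4 * m * m.centralBinom ^ 2) := by gcongr
      _ = 16 * (4 * m * (m + 1)) * m.centralBinom ^ 2 := by ring
      _ ≤ 16 * (2 * m + 1) ^ 2 * m.centralBinom ^ 2 := by gcongr; nlinarith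
      _ = 4 * (2 * (2 * m + 1) * m.centralBinom) ^ 2 := by ring
      _ = 4 * ((m + 1) * (m + 1).centralBinom) ^ 2 := by rw [Nat.succ_mul_centralBinom_succ]
      _ = (m + 1) * (4 * ↑(m + 1) * (m + 1).centralBinom ^ 2) := by ring

theorem le_logb_centralBinom {m : ℕ} (hm : 1 ≤ m) :
    2 * (m : ℝ) - 1 - logb 2 m / 2 ≤ logb 2 m.centralBinom := by
  have hm0 : (m : ℝ) ≠ 0 := by positivity
  have hcb : (m.centralBinom : ℝ) ≠ 0 := by exact_mod_cast m.centralBinom_ne_zero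
  have h : ((2 : ℝ) ^ 4) ^ m ≤ 2 ^ 2 * m * (m.centralBinom : ℝ) ^ 2 := by
    norm_num
    exact_mod_cast sixteen_pow_le_four_mul_mul_centralBinom_sq hm
  have hlog := logb_le_logb_of_le one_lt_two (by positivity) h
  rw [logb_mul (by positivity) (by positivity), logb_mul (by positivity) hm0, logb_pow, logb_pow,
    logb_pow, logb_pow, logb_self_eq_one one_lt_two] at hlog
  push_cast at hlog
  linarith

theorem logb_two_le_self {x : ℝ} (hx : 1 ≤ x) : logb 2 x ≤ x := by
  rw [logb_le_iff_le_rpow one_lt_two (by linarith)]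
  have h := one_add_mul_self_le_rpow_one_add (s := 1) (by norm_num) hx
  norm_num at h
  linarith

theorem exists_add_one_le_logb_centralBinom {x : ℝ} (hx : 8 ≤ x) :
    ∃ m : ℕ, x + 1 ≤ logb 2 m.centralBinom ∧ 2 * (m : ℝ) ≤ x + logb 2 x / 2 + 4 := by
  have hlog0 : 0 ≤ logb 2 x := logb_nonneg one_lt_two (by linarith)
  have hlogx : logb 2 x ≤ x := logb_two_le_self (by linarith)
  set m := ⌈x / 2 + logb 2 x / 4 + 1⌉₊
  have hle : x / 2 + logb 2 x / 4 + 1 ≤ m := Nat.le_ceil _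
  have hlt : (m : ℝ) < x / 2 + logb 2 x / 4 + 1 + 1 := Nat.ceil_lt_add_one (by positivity)
  have hm : (1 : ℝ) ≤ m := by linarith
  have hlogm : logb 2 m ≤ logb 2 x := logb_le_logb_of_le one_lt_two (by linarith) (by linarith)
  have hcb := le_logb_centralBinom (Nat.one_le_cast.mp hm)
  exact ⟨m, by linarith, by linarith⟩

theorem le_two_pow_of_logb_logb_add_one_le {n k : ℕ} (hn : 3 ≤ n)
    (h : logb 2 (logb 2 ((n : ℝ) - 1)) + 1 ≤ logb 2 k) : n ≤ 2 ^ k := by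
  have hn' : (3 : ℝ) ≤ n := by exact_mod_cast hn
  have hlog : 1 ≤ logb 2 ((n : ℝ) - 1) := by
    rw [le_logb_iff_rpow_le one_lt_two (by linarith), rpow_one]
    linarith
  have hk : (0 : ℝ) < k := by
    refine k.cast_nonneg.lt_of_ne' fun hk => ?_
    rw [hk, logb_zero] at h
    linarith [logb_nonneg one_lt_two hlog]
  have hlog_sq : logb 2 (((n : ℝ) - 1) ^ 2) ≤ k := by
    rw [logb_pow, Nat.cast_ofNat, ← logb_le_logb one_lt_two (by linarith) hk,
      logb_mul two_ne_zero (by linarith), logb_self_eq_one one_lt_two, add_comm]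
    exact h
  have hsq : ((n : ℝ) - 1) ^ 2 ≤ 2 ^ k := by
    rwa [logb_le_iff_le_rpow one_lt_two (by nlinarith), rpow_natCast] at hlog_sq
  have hle : (n : ℝ) ≤ 2 ^ k := by nlinarith
  exact_mod_cast hle

theorem one_lt_logb_logb {x : ℝ} (hx : 4 < x) : 1 < logb 2 (logb 2 x) := by
  have hlog : 2 < logb 2 x := by
    rw [lt_logb_iff_rpow_lt one_lt_two (by linarith)]
    norm_num
    exact hx
  rwa [lt_logb_iff_rpow_lt one_lt_two (by linarith), rpow_one]

theorem tendsto_logb_logb_natCast_sub_one :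
    Tendsto (fun n : ℕ => logb 2 (logb 2 ((n : ℝ) - 1))) atTop atTop :=
  (tendsto_logb_atTop one_lt_two).comp <| (tendsto_logb_atTop one_lt_two).comp <|
    tendsto_atTop_add_const_right _ (-1) tendsto_natCast_atTop_atTop

/-- The least `m` for which `m.centralBinom` binary digits are enough to write `n` distinct
colours, that is, for which the middle layer of the subsets of a `2 * m`-set labels the digits. -/
noncomputable def middleLayerRank (n : ℕ) : ℕ :=
  sInf {m : ℕ | n ≤ 2 ^ m.centralBinom}

theorem le_two_pow_centralBinom_middleLayerRank (n : ℕ) :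
    n ≤ 2 ^ (middleLayerRank n).centralBinom :=
  Nat.sInf_mem (s := {m : ℕ | n ≤ 2 ^ m.centralBinom}) ⟨n, Nat.lt_two_pow_self.le.trans
    (Nat.pow_le_pow_right two_pos Nat.centralBinom_strictMono.le_apply)⟩

theorem eventually_two_mul_middleLayerRank_le :
    ∀ᶠ n : ℕ in atTop, 2 * (middleLayerRank n : ℝ) ≤
      logb 2 (logb 2 ((n : ℝ) - 1)) + logb 2 (logb 2 (logb 2 ((n : ℝ) - 1))) / 2 + 4 := by
  filter_upwards [tendsto_logb_logb_natCast_sub_one.eventually_ge_atTop 8, eventually_ge_atTop 3]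
    with n hlarge hn
  obtain ⟨m, hlog, hm⟩ := exists_add_one_le_logb_centralBinom hlarge
  have hrank : middleLayerRank n ≤ m := Nat.sInf_le (le_two_pow_of_logb_logb_add_one_le hn hlog)
  have hrank' : (middleLayerRank n : ℝ) ≤ m := by exact_mod_cast hrank
  linarith

theorem exists_tendsto_zero_forall_le_add_mul {α : Type*} {l : Filter α} {f g y : α → ℝ} {C : ℝ}
    (hy : Tendsto y l atTop) (hfg : ∀ᶠ a in l, f a ≤ g a + C) :
    ∃ ε : α → ℝ, Tendsto ε l (nhds 0) ∧ ∀ a, 0 < y a → f a ≤ g a + ε a * y a := by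
  refine ⟨fun a => max 0 ((f a - g a) / y a), ?_, fun a ha => ?_⟩
  · have hlim : Tendsto (fun a => max 0 (C / y a)) l (nhds 0) := by
      simpa using (tendsto_const_nhds (x := (0 : ℝ))).max (hy.const_div_atTop C)
    refine squeeze_zero' (.of_forall fun a => le_max_left _ _) ?_ hlim
    filter_upwards [hfg, hy.eventually_gt_atTop 0] with a hfa ha
    gcongr
    linarith
  · rw [← sub_le_iff_le_add', ← div_le_iff₀ ha]
    exact le_max_right _ _

end Asymptotics

theorem mainTheorem11 :
    ∃ ε : ℕ → ℝ, Filter.Tendsto ε Filter.atTop (nhds 0) ∧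
      ∀ (V : Type u) [Finite V] (G : SimpleGraph V) (χ : ℕ),
        G.chromaticNumber = (χ : ℕ∞) → 6 ≤ χ →
          (separationDimension (fullSubdivision G) : ℝ) ≤
            Real.logb 2 (Real.logb 2 ((χ : ℝ) - 1)) +
              (1 / 2 + ε χ) * Real.logb 2 (Real.logb 2 (Real.logb 2 ((χ : ℝ) - 1))) + 2 := by
  obtain ⟨ε, hε, hbound⟩ := exists_tendsto_zero_forall_le_add_mul (C := 6)
    (f := fun n : ℕ => 2 * (middleLayerRank n : ℝ) + 4)
    (g := fun n => Real.logb 2 (Real.logb 2 ((n : ℝ) - 1)) +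
      Real.logb 2 (Real.logb 2 (Real.logb 2 ((n : ℝ) - 1))) / 2 + 2)
    ((Real.tendsto_logb_atTop one_lt_two).comp tendsto_logb_logb_natCast_sub_one)
    (eventually_two_mul_middleLayerRank_le.mono fun n hn => by linarith)
  refine ⟨ε, hε, fun V _ G χ hG hχ => ?_⟩
  have hcol : G.Colorable (2 ^ (middleLayerRank χ).centralBinom) :=
    (SimpleGraph.chromaticNumber_le_iff_colorable.mp hG.le).mono
      (le_two_pow_centralBinom_middleLayerRank χ)
  have hdim : (separationDimension (fullSubdivision G) : ℝ) ≤ 2 * middleLayerRank χ + 4 := by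
    exact_mod_cast separationDimension_fullSubdivision_le_two_mul_add_four hcol
  have hχ' : (6 : ℝ) ≤ χ := by exact_mod_cast hχ
  have hlog := Real.logb_pos one_lt_two (one_lt_logb_logb (x := (χ : ℝ) - 1) (by linarith))
  exact (hdim.trans (hbound χ hlog)).trans_eq (by simp only [Function.comp_apply]; ring)
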